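/- **Setting.** Let $X\subseteq\mathbb R^n$ and $Y\subseteq\mathbb R^m$ be nonempty, convex and compact, and let $L:\mathbb R^n\times\mathbb R^m\to[-\infty,+\infty]$ be convex in $x$ for every $\gamma$ and concave in $\gamma$ for every $x$ (convex epigraphs, convex hypographs). Let $$S=\{(x^*,\gamma^*)\in X\times Y:\ L(x^*,\gamma)\le L(x^*,\gamma^*)\le L(x,\gamma^*)\ \ \forall x\in X,\ \forall \gamma\in Y\}$$ be the set of saddle points, and put $$\partial_xL(x,\gamma)=\{g\in\mathbb R^n:\ L(y,\gamma)\ge L(x,\gamma)+\langle g,y-x\rangle\ \ \forall y\in\mathbb R^n\},$$ $$\partial^+_\gamma L(x,\gamma)=\{g\in\mathbb R^m:\ L(x,\delta)\le L(x,\gamma)+\langle g,\delta-\gamma\rangle\ \ \forall \delta\in\mathbb R^m\}.$$ For $x\in X$ let $N_X(x)$ be the normal cone, that is, the polar of the tangent cone to $X$ at $x$; define $N_Y(\gamma)$ in the same way. Assume: 1. $S$ is nonempty and compact, and for every $(x,\gamma)\in(X\times Y)\setminus S$ there is $(x^*,\gamma^*)\in S$ with $L(x^*,\gamma)<L(x^*,\gamma^*)$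 or $L(x^*,\gamma^*)<L(x,\gamma^*)$. 2. For every $x\in X$ the function $L(x,\cdot)$ is upper semicontinuous on $Y$, and for every $\gamma\in Y$ the function $L(\cdot,\gamma)$ is lower semicontinuous on $X$. 3. There is $G>0$ such that for all $(x,\gamma)\in X\times Y$ the sets $\partial_xL(x,\gamma)$ and $\partial^+_\gamma L(x,\gamma)$ are nonempty and all their elements have norm at most $G$. 4. For some $\sigma>0$, $R_x$ and $R_\gamma$ are twice continuously differentiable and $\sigma$-strongly convex on open sets $U\supseteq X$ and $U'\supseteq Y$ respectively, i.e. $R_x(y)\ge R_x(x)+\langle\nabla R_x(x),y-x\rangle+\tfrac{\sigma}{2}\|y-x\|^2$ for $x,y\in U$, and likewise for $R_\gamma$ on $U'$. Consider the continuous-time saddle point mirror descent inclusion $$\dot x\in-\nabla^2R_x(x)^{-1}\bigl(\partial_xL(x,\gamma)+N_X(x)\bigr),\qquad \dot\gamma\in\nabla^2R_\gamma(\gamma)^{-1}\bigl(\partial^+_\gamma L(x,\gamma)-N_Y(\gamma)\bigr).\tag{$*$}$$ A (viable) Carathéodory solution of $(*)$ is a function $[0,\infty)\to X\times Y$, absolutely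 continuous on every bounded interval, that satisfies $(*)$ for almost every $t\ge0$. A point of $X\times Y$ is an equilibrium if $0$ belongs to the right-hand side of $(*)$ there. It is Lyapunov stable if for every $\varepsilon>0$ there is $\delta>0$ such that every Carathéodory solution starting in $X\times Y$ within distance $\delta$ of the point stays within distance $\varepsilon$ of it for all $t\ge0$. **Theorem.** The equilibria of $(*)$ are exactly the saddle points, and every one of them is Lyapunov stable. Furthermore, every Carathéodory solution $(x(t),\gamma(t))$ of $(*)$ with initial condition $(x_0,\gamma_0)\in X\times Y$ converges to $S$, that is, the distance from $(x(t),\gamma(t))$ to $S$ tends to $0$ as $t\to\infty$. -/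

import Mathlib

open Set Filter Topology MeasureTheory
open scoped Pointwise RealInnerProductSpace

namespace SPMD

noncomputable section

/-! ### Differential inclusions on a state set -/

section Inclusion

variable {Z : Type*} [NormedAddCommGroup Z] [NormedSpace ℝ Z]

/-- `z` (restricted to `[0, ∞)`) is a viable Carathéodory solution in the state set `K` of the
differential inclusion `ż ∈ Φ z`: it stays in `K`, it is absolutely continuous on every bounded
interval `[0, T]`, and for almost every `t ≥ 0` the derivative exists and lies in `Φ (z t)`. -/
structure IsViableSolution (K : Set Z) (Φ : Z → Set Z) (z : ℝ → Z) : Prop where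
  mem : ∀ t, 0 ≤ t → z t ∈ K
  absCont : ∀ T, 0 ≤ T → AbsolutelyContinuousOnInterval z 0 T
  deriv_mem : ∀ᵐ t ∂(volume.restrict (Ici (0 : ℝ))), ∃ v ∈ Φ (z t), HasDerivAt z v t

/-- A point of the state set at which `0` belongs to the right-hand side. -/
def IsEquilibrium (K : Set Z) (Φ : Z → Set Z) (p : Z) : Prop :=
  p ∈ K ∧ (0 : Z) ∈ Φ p

/-- Lyapunov stability of a point `p` (with respect to all viable Carathéodory solutions). -/
def IsLyapunovStable (K : Set Z) (Φ : Z → Set Z) (p : Z) : Prop :=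
  ∀ ε > 0, ∃ δ > 0, ∀ z₀ ∈ Metric.ball p δ ∩ K, ∀ z : ℝ → Z,
    IsViableSolution K Φ z → z 0 = z₀ → ∀ t, 0 ≤ t → z t ∈ Metric.ball p ε ∩ K

end Inclusion

/-! ### Convex analysis -/

section Convex

variable {E : Type*} [NormedAddCommGroup E] [InnerProductSpace ℝ E]

/-- Convexity of an extended-real-valued function: its epigraph is convex. -/
def EConvex (f : E → EReal) : Prop :=
  Convex ℝ {p : E × ℝ | f p.1 ≤ (p.2 : EReal)}

/-- Concavity of an extended-real-valued function: its hypograph is convex. -/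
def EConcave (f : E → EReal) : Prop :=
  Convex ℝ {p : E × ℝ | (p.2 : EReal) ≤ f p.1}

/-- The subdifferential `∂f(x)`; the subgradient inequality is required on the whole space. -/
def subdifferential (f : E → EReal) (x : E) : Set E :=
  {g | ∀ y, f x + ((⟪g, y - x⟫ : ℝ) : EReal) ≤ f y}

/-- The superdifferential `∂⁺f(x)`. -/
def superdifferential (f : E → EReal) (x : E) : Set E :=
  {g | ∀ y, f y ≤ f x + ((⟪g, y - x⟫ : ℝ) : EReal)}

/-- The normal cone to `K` at `x`: the polar of the tangent cone. -/
def normalCone (K : Set E) (x : E) : Set E :=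
  {η | ∀ v ∈ posTangentConeAt K x, ⟪η, v⟫ ≤ 0}

variable [CompleteSpace E]

/-- The Hessian of a real function, as a linear operator: the derivative of its gradient. -/
def hessian (R : E → ℝ) (x : E) : E →L[ℝ] E :=
  fderiv ℝ (gradient R) x

/-- `R` is twice continuously differentiable and `σ`-strongly convex on an open set containing `K`.
An extended-real-valued strongly convex function which is `C²` near `K` enters only through its
(real) values near `K`, so `R` is taken real-valued and nothing is assumed of it elsewhere. -/
def IsMirrorMap (σ : ℝ) (K : Set E) (R : E → ℝ) : Prop :=
  ∃ U : Set E, IsOpen U ∧ K ⊆ U ∧ ContDiffOn ℝ 2 R U ∧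
    ∀ x ∈ U, ∀ y ∈ U, R x + ⟪gradient R x, y - x⟫ + σ / 2 * ‖y - x‖ ^ 2 ≤ R y

end Convex

/-! ### Saddle points and the mirror descent inclusion -/

section Saddle

variable {E F : Type*} [NormedAddCommGroup E] [InnerProductSpace ℝ E]
  [NormedAddCommGroup F] [InnerProductSpace ℝ F]

/-- The set of saddle points of `L` on `X × Y` (minimization in `x`, maximization in `γ`). -/
def saddleSet (X : Set E) (Y : Set F) (L : E → F → EReal) : Set (E × F) :=
  {p | p ∈ X ×ˢ Y ∧ ∀ x ∈ X, ∀ γ ∈ Y, L p.1 γ ≤ L p.1 p.2 ∧ L p.1 p.2 ≤ L x p.2}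

/-- The right-hand side of the saddle point mirror descent inclusion,
`ẋ ∈ -∇²R_x(x)⁻¹ (∂ₓL(x,γ) + N_X(x))`, `γ̇ ∈ ∇²R_γ(γ)⁻¹ (∂⁺_γ L(x,γ) - N_Y(γ))`. -/
def mirrorField [CompleteSpace E] [CompleteSpace F] (X : Set E) (Y : Set F) (L : E → F → EReal)
    (Rx : E → ℝ) (Rγ : F → ℝ) (p : E × F) : Set (E × F) :=
  (-((hessian Rx p.1).inverse '' (subdifferential (fun x => L x p.2) p.1 + normalCone X p.1))) ×ˢ
    ((hessian Rγ p.2).inverse '' (superdifferential (fun γ => L p.1 γ) p.2 - normalCone Y p.2))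

end Saddle

end

end SPMD

/-!
The Lyapunov functions are the sums of the Bregman divergences of a saddle point `q = (a, b)` from
the current point `(x, γ)`. If `ẋ = -∇²R(x)⁻¹ (g + η)` with `g` a subgradient and `η` a normal
vector, then the divergence of `a` from `x` changes at the rate `⟪g + η, a - x⟫`, which the
subgradient inequality and convexity of `X` bound by `L(a, γ) - L(x, γ)`. The superdifferential of
`L(x, ·)` is minus the subdifferential of `-L(x, ·)`, so the second variable is subject to the same
one-sided estimate, and the sum of the two rates is at most `L(a, γ) - L(x, b) ≤ 0`
(`SPMD.IsViableSolution.lyapunov_sub_le`). Strong convexity bounds the divergences below by squared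
distances, whence Lyapunov stability.

For convergence no invariance principle is needed. A viable solution is differentiable from both
sides at almost every time, so its velocity is tangent to `X × Y` in both directions, the normal
forces do no work, and the velocity is at most `G / σ` (`SPMD.norm_le_of_mem_descentField`). If a
solution had a cluster point outside the saddle set, then for a suitable `q` semicontinuity would
keep the gap `L(x, b) - L(a, γ)` above a positive constant near that point
(`SPMD.exists_eventually_gap`). Being Lipschitz, the solution would spend infinitely many time
intervals of a fixed length there, and the Lyapunov function of `q` would become negative
(`SPMD.mem_saddleSet_of_mapClusterPt`).

That equilibria are saddle points is the subgradient inequality. The converse is the optimality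
condition `0 ∈ ∂f(x) + N_K(x)` at a minimizer
(`SPMD.exists_mem_subdifferential_neg_mem_normalCone`). No interiority is available, but bounded
subgradients are: limits of subgradients along a segment provide, for each direction into `K`, a
subgradient nonnegative in that direction, and Sion's minimax theorem provides a single subgradient
for all directions. Finiteness of `L` on `X × Y` also comes from boundedness of the subdifferentials
(`SPMD.exists_coe_eq_of_subdifferential`), except when both spaces are trivial.
-/

/-! ### Absolutely continuous functions -/

/-- A Lipschitz function of an absolutely continuous function is absolutely continuous. -/
theorem LipschitzOnWith.comp_absolutelyContinuousOnInterval {α β : Type*}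
    [PseudoMetricSpace α] [PseudoMetricSpace β] {f : α → β} {g : ℝ → α} {s : Set α} {C : NNReal}
    {a b : ℝ} (hf : LipschitzOnWith C f s) (hg : AbsolutelyContinuousOnInterval g a b)
    (hgs : MapsTo g (uIcc a b) s) : AbsolutelyContinuousOnInterval (f ∘ g) a b := by
  rw [absolutelyContinuousOnInterval_iff] at hg ⊢
  intro ε hε
  obtain ⟨δ, hδ, h⟩ := hg (ε / (C + 1)) (by positivity)
  refine ⟨δ, hδ, fun I hI hIδ ↦ ?_⟩
  calc ∑ i ∈ Finset.range I.1, dist ((f ∘ g) (I.2 i).1) ((f ∘ g) (I.2 i).2)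
      ≤ ∑ i ∈ Finset.range I.1, C * dist (g (I.2 i).1) (g (I.2 i).2) :=
        Finset.sum_le_sum fun i hi ↦
          hf.dist_le_mul _ (hgs (hI.1 i hi).1) _ (hgs (hI.1 i hi).2)
    _ = C * ∑ i ∈ Finset.range I.1, dist (g (I.2 i).1) (g (I.2 i).2) := by
        rw [Finset.mul_sum]
    _ ≤ C * (ε / (C + 1)) := by gcongr; exact (h I hI hIδ).le
    _ < (C + 1) * (ε / (C + 1)) := by gcongr; linarith
    _ = ε := by field

theorem AbsolutelyContinuousOnInterval.sub_le_mul_sub {f : ℝ → ℝ} {a b C : ℝ} (hab : a ≤ b)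
    (hf : AbsolutelyContinuousOnInterval f a b)
    (h : ∀ᵐ t, t ∈ Ioo a b → ∃ d ≤ C, HasDerivAt f d t) : f b - f a ≤ C * (b - a) := by
  rw [← hf.integral_deriv_eq_sub]
  calc ∫ t in a..b, deriv f t ≤ ∫ _ in a..b, C := by
        refine intervalIntegral.integral_mono_ae_restrict hab hf.intervalIntegrable_deriv
          intervalIntegrable_const ?_
        rw [← restrict_Ioo_eq_restrict_Icc]
        refine (ae_restrict_iff' measurableSet_Ioo).2 (h.mono fun t ht hmem ↦ ?_)
        obtain ⟨d, hd, hder⟩ := ht hmem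
        rwa [hder.deriv]
    _ = C * (b - a) := by simp [mul_comm]

/-- The mean value inequality for absolutely continuous curves. Pairing the curve with its own
displacement reduces it to a real-valued function. -/
theorem AbsolutelyContinuousOnInterval.norm_sub_le_mul_sub {H : Type*} [NormedAddCommGroup H]
    [InnerProductSpace ℝ H] {f : ℝ → H} {a b C : ℝ} (hab : a ≤ b) (hC : 0 ≤ C)
    (hf : AbsolutelyContinuousOnInterval f a b)
    (h : ∀ᵐ t, t ∈ Ioo a b → ∃ v, ‖v‖ ≤ C ∧ HasDerivAt f v t) :
    ‖f b - f a‖ ≤ C * (b - a) := by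
  set u := f b - f a with hu
  have hbd : innerSL ℝ u (f b) - innerSL ℝ u (f a) ≤ (‖u‖ * C) * (b - a) := by
    refine AbsolutelyContinuousOnInterval.sub_le_mul_sub (f := innerSL ℝ u ∘ f) hab
      ((innerSL ℝ u).lipschitz.lipschitzOnWith.comp_absolutelyContinuousOnInterval hf
        (mapsTo_univ _ _)) ?_
    filter_upwards [h] with t ht hmem
    obtain ⟨v, hv, hder⟩ := ht hmem
    exact ⟨_, (real_inner_le_norm u v).trans (mul_le_mul_of_nonneg_left hv (norm_nonneg u)),
      (innerSL ℝ u).hasFDerivAt.comp_hasDerivAt t hder⟩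
  rw [← map_sub, ← hu, innerSL_apply_apply, real_inner_self_eq_norm_sq] at hbd
  rcases (norm_nonneg u).eq_or_lt with h0 | h0
  · rw [← h0]
    exact mul_nonneg hC (sub_nonneg.2 hab)
  · refine le_of_mul_le_mul_left ?_ h0
    linarith

namespace SPMD

/-! ### Subgradients and normal vectors -/

section Convex

variable {E : Type*} [NormedAddCommGroup E] [InnerProductSpace ℝ E]

theorem inner_sub_nonpos_of_mem_normalCone {K : Set E} (hK : Convex ℝ K) {x y η : E}
    (hx : x ∈ K) (hy : y ∈ K) (hη : η ∈ normalCone K x) : ⟪η, y - x⟫ ≤ 0 :=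
  hη _ (sub_mem_posTangentConeAt_of_segment_subset (hK.segment_subset hx hy))

theorem mem_normalCone_of_forall_inner_sub_nonpos {K : Set E} {x η : E}
    (h : ∀ y ∈ K, ⟪η, y - x⟫ ≤ 0) : η ∈ normalCone K x := by
  intro v hv
  obtain ⟨α, l, hl, c, d, -, hd, hcd⟩ := exists_fun_of_mem_tangentConeAt hv
  refine le_of_tendsto ((continuous_const.inner continuous_id).tendsto v |>.comp hcd) ?_
  filter_upwards [hd] with n hn
  have := h _ hn
  rw [add_sub_cancel_left] at this
  change ⟪η, (c n : ℝ) • d n⟫ ≤ 0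
  rw [real_inner_smul_right]
  exact mul_nonpos_of_nonneg_of_nonpos (c n).2 this

theorem mem_superdifferential_iff {f : E → EReal} {x g : E} :
    g ∈ superdifferential f x ↔ -g ∈ subdifferential (fun y ↦ -f y) x := by
  refine forall_congr' fun y ↦ ?_
  rw [← EReal.neg_le_neg_iff, EReal.neg_add (Or.inr (EReal.coe_ne_top _))
    (Or.inr (EReal.coe_ne_bot _)), inner_neg_left, EReal.coe_neg, sub_eq_add_neg]

/-- At an infinite value of `f` every vector is a subgradient as soon as one is, so bounded
subdifferentials force finite values, except on the zero space. -/
theorem exists_coe_eq_of_subdifferential [Nontrivial E] {f : E → EReal} {x : E} {G : ℝ}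
    (hne : (subdifferential f x).Nonempty) (hG : ∀ g ∈ subdifferential f x, ‖g‖ ≤ G) :
    ∃ c : ℝ, f x = c := by
  obtain ⟨g, hg⟩ := NormedSpace.exists_lt_norm ℝ E G
  obtain ⟨g₀, hg₀⟩ := hne
  induction hx : f x using EReal.rec with
  | bot => exact absurd (hG g fun y ↦ by simp [hx]) hg.not_ge
  | coe c => exact ⟨c, rfl⟩
  | top =>
    refine absurd (hG g fun y ↦ ?_) hg.not_ge
    have := hg₀ y
    simp only [hx, EReal.top_add_coe, top_le_iff] at this ⊢
    exact this

theorem subdifferential_eq_iInter {f : E → EReal} {x : E} {c : ℝ} (hc : f x = c)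
    (hbot : ∀ y, f y ≠ ⊥) :
    subdifferential f x = ⋂ y ∈ {y | f y ≠ ⊤}, {g | ⟪g, y - x⟫ ≤ (f y).toReal - c} := by
  ext g
  simp only [subdifferential, mem_ofPred_eq, mem_iInter, hc]
  refine forall_congr' fun y ↦ ?_
  induction hy : f y using EReal.rec with
  | bot => exact absurd hy (hbot y)
  | coe d => 
    simp only [ne_eq, EReal.coe_ne_top, not_false_eq_true, EReal.toReal_coe, forall_const]
    rw [← EReal.coe_add, EReal.coe_le_coe_iff, le_sub_iff_add_le']
  | top => simp

theorem isClosed_subdifferential {f : E → EReal} {x : E} {c : ℝ} (hc : f x = c)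
    (hbot : ∀ y, f y ≠ ⊥) : IsClosed (subdifferential f x) := by
  rw [subdifferential_eq_iInter hc hbot]
  exact isClosed_biInter fun y _ ↦
    isClosed_le (continuous_id.inner continuous_const) continuous_const

theorem convex_subdifferential {f : E → EReal} {x : E} {c : ℝ} (hc : f x = c)
    (hbot : ∀ y, f y ≠ ⊥) : Convex ℝ (subdifferential f x) := by
  rw [subdifferential_eq_iInter hc hbot]
  refine convex_iInter₂ fun y _ ↦ convex_halfSpace_le (f := fun g ↦ ⟪g, y - x⟫) ⟨?_, ?_⟩ _
  · exact fun g h ↦ inner_add_left ..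
  · exact fun r g ↦ real_inner_smul_left ..

theorem ne_bot_of_mem_subdifferential {f : E → EReal} {x g : E} {c : ℝ} (hc : f x = c)
    (hg : g ∈ subdifferential f x) (y : E) : f y ≠ ⊥ := fun h ↦ by
  have := hg y
  rw [hc, h, ← EReal.coe_add, le_bot_iff] at this
  exact EReal.coe_ne_bot _ this

variable [FiniteDimensional ℝ E]

/-- At a minimizer over `K`, for each `a ∈ K` some subgradient is nonnegative in the direction of
`a`: it is a limit of subgradients at points of the segment from `x` to `a`. -/
theorem exists_mem_subdifferential_inner_sub_nonneg {K : Set E} (hK : Convex ℝ K)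
    {f : E → EReal} {x a : E} {G c : ℝ} (hx : x ∈ K) (ha : a ∈ K) (hc : f x = c)
    (hmin : ∀ y ∈ K, f x ≤ f y) (hne : ∀ y ∈ K, (subdifferential f y).Nonempty)
    (hG : ∀ y ∈ K, ∀ g ∈ subdifferential f y, ‖g‖ ≤ G) :
    ∃ g ∈ subdifferential f x, 0 ≤ ⟪g, a - x⟫ := by
  set τ : ℕ → ℝ := fun k ↦ 1 / ((k : ℝ) + 1) with hτ
  have hτ0 : Tendsto τ atTop (𝓝 0) := tendsto_one_div_add_atTop_nhds_zero_nat
  have hτpos (k) : 0 < τ k := by positivity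
  have hmem (k) : x + τ k • (a - x) ∈ K := by
    refine hK.add_smul_sub_mem hx ha ⟨(hτpos k).le, ?_⟩
    rw [hτ]; exact (div_le_one (by positivity)).2 (by simp)
  choose g hg using fun k ↦ hne _ (hmem k)
  have key (k) (y) : (c : EReal) + (⟪g k, y - (x + τ k • (a - x))⟫ : ℝ) ≤ f y :=
    (add_le_add_left (hc ▸ hmin _ (hmem k)) _).trans (hg k y)
  have hdir (k) : 0 ≤ ⟪g k, a - x⟫ := by
    have := key k x
    rw [hc, ← EReal.coe_add, EReal.coe_le_coe_iff, sub_add_cancel_left, inner_neg_right,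
      real_inner_smul_right] at this
    exact nonneg_of_mul_nonneg_right (by linarith) (hτpos k)
  obtain ⟨g₀, -, φ, hφ, hlim⟩ := (isCompact_closedBall (0 : E) G).tendsto_subseq
    (x := g) fun k ↦ by simpa using hG _ (hmem k) _ (hg k)
  refine ⟨g₀, fun y ↦ ?_, ge_of_tendsto' (hlim.inner tendsto_const_nhds) fun k ↦ hdir _⟩
  have hlim' : Tendsto (fun k ↦ c + ⟪g (φ k), y - (x + τ (φ k) • (a - x))⟫) atTop
      (𝓝 (c + ⟪g₀, y - (x + (0 : ℝ) • (a - x))⟫)) :=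
    tendsto_const_nhds.add (hlim.inner (tendsto_const_nhds.sub (tendsto_const_nhds.add
      ((hτ0.comp hφ.tendsto_atTop).smul_const _))))
  rw [zero_smul, add_zero] at hlim'
  rw [hc, ← EReal.coe_add]
  refine le_of_tendsto' ((continuous_coe_real_ereal.tendsto _).comp hlim') fun k ↦ ?_
  simpa using key (φ k) y

/-- The first-order optimality condition for a function whose subdifferentials on `K` are nonempty
and uniformly bounded. The minimax theorem, applied to the pairing `⟪g, y - x⟫` on `K × ∂f(x)`,
turns subgradients that depend on the direction into a single one. -/
theorem exists_mem_subdifferential_neg_mem_normalCone {K : Set E} (hK : Convex ℝ K)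
    (hKc : IsCompact K) {f : E → EReal} {x : E} {G : ℝ} (hx : x ∈ K)
    (hmin : ∀ y ∈ K, f x ≤ f y) (hne : ∀ y ∈ K, (subdifferential f y).Nonempty)
    (hG : ∀ y ∈ K, ∀ g ∈ subdifferential f y, ‖g‖ ≤ G) :
    ∃ g ∈ subdifferential f x, -g ∈ normalCone K x := by
  rcases subsingleton_or_nontrivial E with _ | _
  · obtain ⟨g, hg⟩ := hne x hx
    exact ⟨g, hg, mem_normalCone_of_forall_inner_sub_nonpos fun y _ ↦ by
      simp [Subsingleton.elim y x]⟩
  obtain ⟨c, hc⟩ := exists_coe_eq_of_subdifferential (hne x hx) (hG x hx)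
  have hbot := ne_bot_of_mem_subdifferential hc (hne x hx).choose_spec
  have hCc : IsCompact (subdifferential f x) :=
    (isCompact_closedBall (0 : E) G).of_isClosed_subset (isClosed_subdifferential hc hbot)
      fun g hg ↦ by simpa using hG x hx g hg
  have hcK (g : E) : Continuous fun y ↦ ⟪g, y - x⟫ :=
    continuous_const.inner (continuous_id.sub continuous_const)
  have hcC (y : E) : Continuous fun g ↦ ⟪g, y - x⟫ := continuous_id.inner continuous_const
  obtain ⟨a, ha, b, hb, hab⟩ := Sion.exists_isSaddlePointOn (f := fun y g ↦ ⟪g, y - x⟫)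
    ⟨x, hx⟩ hK hKc (fun g _ ↦ (hcK g).lowerSemicontinuous.lowerSemicontinuousOn _)
    (fun g _ ↦ ConvexOn.quasiconvexOn ⟨hK, fun y _ w _ p q _ _ hpq ↦ by
      refine le_of_eq ?_
      simp only [inner_sub_right, inner_add_right, real_inner_smul_right, smul_eq_mul]
      linear_combination ⟪g, x⟫ * hpq⟩)
    (convex_subdifferential hc hbot) (hne x hx) hCc
    (fun y _ ↦ (hcC y).upperSemicontinuous.upperSemicontinuousOn _)
    (fun y _ ↦ ConcaveOn.quasiconcaveOn ⟨convex_subdifferential hc hbot,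
      fun g _ h _ p q _ _ _ ↦ by
        simp only [inner_add_left, real_inner_smul_left, smul_eq_mul, le_refl]⟩)
  refine ⟨b, hb, mem_normalCone_of_forall_inner_sub_nonpos fun y hy ↦ ?_⟩
  obtain ⟨g, hg, hga⟩ := exists_mem_subdifferential_inner_sub_nonneg hK hx ha hc hmin hne hG
  rw [inner_neg_left, neg_nonpos]
  exact hga.trans (hab y hy g hg)

end Convex

/-! ### Mirror maps and the Bregman divergence -/

section Mirror

variable {E : Type*} [NormedAddCommGroup E] [InnerProductSpace ℝ E] [CompleteSpace E]

/-- The Bregman divergence `R a - R x - ⟪∇R x, a - x⟫` of `a` from `x`. -/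
noncomputable def bregman (R : E → ℝ) (a x : E) : ℝ :=
  R a - R x - ⟪gradient R x, a - x⟫

@[simp]
theorem bregman_self (R : E → ℝ) (a : E) : bregman R a a = 0 := by simp [bregman]

namespace IsMirrorMap

variable {σ : ℝ} {K : Set E} {R : E → ℝ}

theorem contDiffAt_gradient (hR : IsMirrorMap σ K R) {x : E} (hx : x ∈ K) :
    ContDiffAt ℝ 1 (gradient R) x := by
  obtain ⟨U, hU, hKU, hd, -⟩ := hR
  have : ContDiffAt ℝ 1 (fderiv ℝ R) x :=
    (hd.fderiv_of_isOpen hU (by norm_num)).contDiffAt (hU.mem_nhds (hKU hx))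
  exact (InnerProductSpace.toDual ℝ E).symm.contDiff.contDiffAt.comp x this

theorem contDiffAt (hR : IsMirrorMap σ K R) {x : E} (hx : x ∈ K) : ContDiffAt ℝ 2 R x := by
  obtain ⟨U, hU, hKU, hd, -⟩ := hR
  exact hd.contDiffAt (hU.mem_nhds (hKU hx))

theorem hasFDerivAt_gradient (hR : IsMirrorMap σ K R) {x : E} (hx : x ∈ K) :
    HasFDerivAt (gradient R) (hessian R x) x :=
  ((hR.contDiffAt_gradient hx).differentiableAt (by norm_num)).hasFDerivAt

/-- Strong convexity, in its second-order form: it follows from the strong monotonicity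
`σ ‖y - x‖² ≤ ⟪∇R y - ∇R x, y - x⟫` by differentiation along lines. -/
theorem le_inner_hessian (hR : IsMirrorMap σ K R) {x : E} (hx : x ∈ K) (v : E) :
    σ * ‖v‖ ^ 2 ≤ ⟪hessian R x v, v⟫ := by
  have hline : HasDerivAt (fun t : ℝ ↦ gradient R (x + t • v)) (hessian R x v) 0 := by
    have h := (hR.hasFDerivAt_gradient hx)
    rw [show x = x + (0 : ℝ) • v by simp] at h
    have h2 : HasDerivAt (fun t : ℝ ↦ x + t • v) v 0 := by
      simpa using ((hasDerivAt_id (0 : ℝ)).smul_const v).const_add x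
    simpa [Function.comp_def] using h.comp_hasDerivAt 0 h2
  have hlim := hline.tendsto_slope_zero_right.inner (𝕜 := ℝ) (tendsto_const_nhds (x := v))
  refine ge_of_tendsto hlim ?_
  obtain ⟨U, hU, hKU, -, hconv⟩ := hR
  have hcont : Tendsto (fun t : ℝ ↦ x + t • v) (𝓝[>] 0) (𝓝 x) := by
    have : Continuous fun t : ℝ ↦ x + t • v := by fun_prop
    simpa using (this.tendsto 0).mono_left nhdsWithin_le_nhds
  filter_upwards [hcont.eventually (hU.mem_nhds (hKU hx)), self_mem_nhdsWithin] with t htU ht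
  have ht : 0 < t := ht
  have h1 := hconv _ (hKU hx) _ htU
  have h2 := hconv _ htU _ (hKU hx)
  simp only [add_sub_cancel_left, sub_add_cancel_left, inner_neg_right, real_inner_smul_right,
    norm_neg, norm_smul, Real.norm_eq_abs, mul_pow, sq_abs] at h1 h2
  simp only [zero_add, zero_smul, add_zero, inner_smul_left, inner_sub_left, conj_trivial]
  rw [inv_mul_eq_div, le_div_iff₀ ht]
  refine le_of_mul_le_mul_left ?_ ht
  linarith

theorem div_two_mul_sq_le_bregman (hR : IsMirrorMap σ K R) {a x : E} (ha : a ∈ K) (hx : x ∈ K) :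
    σ / 2 * ‖a - x‖ ^ 2 ≤ bregman R a x := by
  obtain ⟨U, -, hKU, -, hconv⟩ := hR
  have := hconv x (hKU hx) a (hKU ha)
  rw [bregman]
  linarith

theorem bregman_nonneg (hR : IsMirrorMap σ K R) (hσ : 0 < σ) {a x : E} (ha : a ∈ K)
    (hx : x ∈ K) : 0 ≤ bregman R a x :=
  le_trans (by positivity) (hR.div_two_mul_sq_le_bregman ha hx)

theorem contDiffOn_bregman (hR : IsMirrorMap σ K R) (a : E) : ContDiffOn ℝ 1 (bregman R a) K :=
  fun _ hx ↦ ((contDiffAt_const.sub ((hR.contDiffAt hx).of_le (by norm_num))).sub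
    ((hR.contDiffAt_gradient hx).inner ℝ
      (contDiffAt_const.sub contDiffAt_id))).contDiffWithinAt

/-- Along a curve with velocity `v` the Bregman divergence from `a` changes at the rate
`⟪∇²R(x) v, x - a⟫`: the terms `⟪∇R(x), v⟫` cancel. -/
theorem hasDerivAt_bregman (hR : IsMirrorMap σ K R) (a : E) {x : ℝ → E} {v : E} {t : ℝ}
    (hx : HasDerivAt x v t) (hxK : x t ∈ K) :
    HasDerivAt (fun s ↦ bregman R a (x s)) ⟪hessian R (x t) v, x t - a⟫ t := by
  have hR1 : HasDerivAt (fun s ↦ R (x s)) ⟪gradient R (x t), v⟫ t := by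
    have := ((hR.contDiffAt hxK).differentiableAt (by norm_num)).hasFDerivAt.comp_hasDerivAt t hx
    rwa [inner_gradient_left]
  have hR2 := (hR.hasFDerivAt_gradient hxK).comp_hasDerivAt t hx
  have := (hR1.const_sub (R a)).sub (hR2.inner ℝ (hx.const_sub a))
  refine this.congr_deriv ?_
  rw [inner_neg_right, ← neg_sub a, inner_neg_right]
  simp

theorem isInvertible_hessian [FiniteDimensional ℝ E] (hR : IsMirrorMap σ K R) (hσ : 0 < σ)
    {x : E} (hx : x ∈ K) : (hessian R x).IsInvertible := by
  have hinj : Function.Injective (hessian R x : E →ₗ[ℝ] E) := by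
    refine (injective_iff_map_eq_zero _).2 fun v hv ↦ ?_
    have h := hR.le_inner_hessian hx v
    rw [show hessian R x v = 0 from hv, inner_zero_left] at h
    have : ‖v‖ ^ 2 ≤ 0 := nonpos_of_mul_nonpos_right h hσ
    simpa using this
  exact ⟨(LinearEquiv.ofInjectiveEndo _ hinj).toContinuousLinearEquiv, by ext; rfl⟩

end IsMirrorMap

/-! ### The one-sided mirror descent field -/

/-- The field `-∇²R(x)⁻¹ (∂f(x) + N_K(x))` of mirror descent for the minimization of `f` over `K`.
The saddle point field is a product of two such fields, for `L(·, γ)` and for `-L(x, ·)`. -/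
noncomputable def descentField (K : Set E) (f : E → EReal) (R : E → ℝ) (x : E) : Set E :=
  -((hessian R x).inverse '' (subdifferential f x + normalCone K x))

theorem mem_descentField_iff {K : Set E} {f : E → EReal} {R : E → ℝ} {x v : E}
    (hinv : (hessian R x).IsInvertible) :
    v ∈ descentField K f R x ↔
      ∃ g ∈ subdifferential f x, ∃ η ∈ normalCone K x, hessian R x v = -(g + η) := by
  constructor
  · rintro ⟨w, ⟨g, hg, η, hη, rfl⟩, hw⟩
    exact ⟨g, hg, η, hη, by simpa using congrArg Neg.neg (hinv.inverse_apply_eq.1 hw).symm⟩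
  · rintro ⟨g, hg, η, hη, h⟩
    exact ⟨g + η, ⟨g, hg, η, hη, rfl⟩, hinv.inverse_apply_eq.2 (by rw [map_neg, h, neg_neg])⟩

variable {F : Type*} [NormedAddCommGroup F] [InnerProductSpace ℝ F] [CompleteSpace F]

theorem mirrorField_eq_prod (X : Set E) (Y : Set F) (L : E → F → EReal) (Rx : E → ℝ)
    (Rγ : F → ℝ) (p : E × F) :
    mirrorField X Y L Rx Rγ p =
      descentField X (fun x ↦ L x p.2) Rx p.1 ×ˢ descentField Y (fun γ ↦ -L p.1 γ) Rγ p.2 := by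
  have h : superdifferential (fun γ ↦ L p.1 γ) p.2 =
      -subdifferential (fun γ ↦ -L p.1 γ) p.2 := by
    ext g
    exact mem_superdifferential_iff
  rw [mirrorField, descentField, descentField, h, ← neg_add', ← image_neg_eq_neg (α := F),
    ← image_neg_eq_neg (α := F), image_image, image_image]
  simp only [map_neg]

variable [FiniteDimensional ℝ E] {σ G : ℝ} {K : Set E} {R : E → ℝ} {f : E → EReal}

theorem zero_mem_descentField_iff (hK : Convex ℝ K) (hKc : IsCompact K) (hR : IsMirrorMap σ K R)
    (hσ : 0 < σ) (hne : ∀ y ∈ K, (subdifferential f y).Nonempty)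
    (hG : ∀ y ∈ K, ∀ g ∈ subdifferential f y, ‖g‖ ≤ G) {x : E} (hx : x ∈ K) :
    0 ∈ descentField K f R x ↔ ∀ y ∈ K, f x ≤ f y := by
  rw [mem_descentField_iff (hR.isInvertible_hessian hσ hx)]
  constructor
  · rintro ⟨g, hg, η, hη, h⟩ y hy
    rw [map_zero, zero_eq_neg, ← eq_neg_iff_add_eq_zero] at h
    have hnonneg : 0 ≤ ⟪g, y - x⟫ := by
      rw [h, inner_neg_left, neg_nonneg]
      exact inner_sub_nonpos_of_mem_normalCone hK hx hy hη
    exact (le_add_of_nonneg_right (EReal.coe_nonneg.2 hnonneg)).trans (hg y)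
  · intro hmin
    obtain ⟨g, hg, hη⟩ := exists_mem_subdifferential_neg_mem_normalCone hK hKc hx hmin hne hG
    exact ⟨g, hg, -g, hη, by simp⟩

/-- Two-sided tangency annihilates the normal force, so the velocity is bounded by the
subgradients alone. -/
theorem norm_le_of_mem_descentField (hR : IsMirrorMap σ K R) (hσ : 0 < σ) {x v : E} (hx : x ∈ K)
    (hG : ∀ g ∈ subdifferential f x, ‖g‖ ≤ G) (hv : v ∈ descentField K f R x)
    (htan : v ∈ posTangentConeAt K x) (htan' : -v ∈ posTangentConeAt K x) : ‖v‖ ≤ G / σ := by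
  obtain ⟨g, hg, η, hη, h⟩ := (mem_descentField_iff (hR.isInvertible_hessian hσ hx)).1 hv
  have h0 : ⟪η, v⟫ = 0 := by
    refine le_antisymm (hη v htan) ?_
    simpa using hη _ htan'
  have h1 := hR.le_inner_hessian hx v
  rw [h, inner_neg_left, inner_add_left, h0, add_zero] at h1
  have h2 : -⟪g, v⟫ ≤ ‖g‖ * ‖v‖ := (neg_le_abs _).trans (abs_real_inner_le_norm g v)
  have h3 : ‖g‖ * ‖v‖ ≤ G * ‖v‖ := by gcongr; exact hG g hg
  rw [le_div_iff₀ hσ]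
  rcases (norm_nonneg v).eq_or_lt with h4 | h4
  · rw [← h4, zero_mul]
    exact (norm_nonneg g).trans (hG g hg)
  · refine le_of_mul_le_mul_right ?_ h4
    linarith

/-- Along a curve with velocity in the descent field, the rate `r` at which the Bregman divergence
from `a ∈ K` changes satisfies `f x + r ≤ f a`. -/
theorem exists_hasDerivAt_bregman (hK : Convex ℝ K) (hR : IsMirrorMap σ K R) (hσ : 0 < σ)
    {a v : E} {x : ℝ → E} {t : ℝ} (ha : a ∈ K) (hxK : x t ∈ K) (hx : HasDerivAt x v t)
    (hv : v ∈ descentField K f R (x t)) :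
    ∃ r : ℝ, HasDerivAt (fun s ↦ bregman R a (x s)) r t ∧ f (x t) + r ≤ f a := by
  refine ⟨_, hR.hasDerivAt_bregman a hx hxK, ?_⟩
  obtain ⟨g, hg, η, hη, h⟩ := (mem_descentField_iff (hR.isInvertible_hessian hσ hxK)).1 hv
  refine le_trans ?_ (hg a)
  gcongr
  rw [h, ← neg_sub a, inner_neg_neg, inner_add_left]
  linarith [inner_sub_nonpos_of_mem_normalCone hK hxK ha hη]

end Mirror

/-- The velocity of a curve that stays in `K` after and before time `t` is tangent to `K` in both
directions. -/
theorem mem_posTangentConeAt_of_hasDerivAt {E : Type*} [NormedAddCommGroup E] [NormedSpace ℝ E]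
    {K : Set E} {x : ℝ → E} {v : E} {t : ℝ} (hx : HasDerivAt x v t)
    (hK : ∀ᶠ s in 𝓝 t, x s ∈ K) :
    v ∈ posTangentConeAt K (x t) ∧ -v ∈ posTangentConeAt K (x t) := by
  have key {y : ℝ → E} {w : E} (hy : HasDerivAt y w 0) (hyK : ∀ᶠ s in 𝓝 0, y s ∈ K) :
      w ∈ posTangentConeAt K (y 0) := by
    have hslope := hy.tendsto_slope_zero_right
    simp only [zero_add] at hslope
    refine mem_tangentConeAt_of_seq (𝓝[>] (0 : ℝ)) (fun s ↦ Real.toNNReal s⁻¹)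
      (fun s ↦ y s - y 0) ?_ ?_ ?_
    · simpa using ((hy.continuousAt.tendsto.sub_const (y 0)).mono_left nhdsWithin_le_nhds)
    · simpa using hyK.filter_mono nhdsWithin_le_nhds
    · refine hslope.congr' ?_
      filter_upwards [self_mem_nhdsWithin] with s hs
      change _ = ((Real.toNNReal s⁻¹ : NNReal) : ℝ) • (y s - y 0)
      rw [Real.coe_toNNReal _ (inv_nonneg.2 (le_of_lt hs))]
  constructor
  · have h1 : HasDerivAt (fun s ↦ x (t + s)) v 0 := by
      rw [← add_zero t] at hx
      simpa using hx.comp_const_add t 0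
    have h2 : Tendsto (fun s ↦ t + s) (𝓝 0) (𝓝 t) := by
      simpa using (continuous_const_add t).tendsto 0
    simpa using key h1 (h2.eventually hK)
  · have h1 : HasDerivAt (fun s ↦ x (t - s)) (-v) 0 := by
      rw [← sub_zero t] at hx
      simpa using hx.comp_const_sub t 0
    have h2 : Tendsto (fun s ↦ t - s) (𝓝 0) (𝓝 t) := by
      simpa using (continuous_sub_left t).tendsto 0
    simpa using key h1 (h2.eventually hK)

/-! ### The duality gap away from the saddle set -/

/-- Off the saddle set, some saddle point `q` sees a duality gap `L(x, q.2) - L(q.1, γ)` bounded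
below by a positive constant on a whole neighbourhood, by semicontinuity. -/
theorem exists_eventually_gap {E F : Type*} [NormedAddCommGroup E] [InnerProductSpace ℝ E]
    [NormedAddCommGroup F] [InnerProductSpace ℝ F] {X : Set E} {Y : Set F} {L : E → F → EReal}
    {p : E × F}
    (hfin : ∀ x ∈ X, ∀ γ ∈ Y, ∃ c : ℝ, L x γ = c)
    (hsep : ∃ q ∈ saddleSet X Y L, L q.1 p.2 < L q.1 q.2 ∨ L q.1 q.2 < L p.1 q.2)
    (husc : ∀ x ∈ X, UpperSemicontinuousOn (fun γ ↦ L x γ) Y)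
    (hlsc : ∀ γ ∈ Y, LowerSemicontinuousOn (fun x ↦ L x γ) X) (hp : p ∈ X ×ˢ Y) :
    ∃ q ∈ saddleSet X Y L, ∃ α β : ℝ, α < β ∧
      ∀ᶠ w in 𝓝[X ×ˢ Y] p, L q.1 w.2 ≤ α ∧ β ≤ L w.1 q.2 := by
  obtain ⟨q, hq, h⟩ := hsep
  obtain ⟨c, hc⟩ := hfin _ hq.1.1 _ hq.1.2
  refine ⟨q, hq, ?_⟩
  rw [hc] at h
  rcases h with h | h
  · obtain ⟨α, h1, h2⟩ := EReal.lt_iff_exists_real_btwn.1 h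
    refine ⟨α, c, EReal.coe_lt_coe_iff.1 h2, ?_⟩
    have hev := (tendsto_snd.mono_left (nhdsWithin_prod_eq p.1 p.2 X Y).le).eventually
      (husc _ hq.1.1 _ hp.2 _ h1)
    filter_upwards [hev, self_mem_nhdsWithin] with w hw hwK
    exact ⟨hw.le, hc ▸ (hq.2 _ hwK.1 _ hwK.2).2⟩
  · obtain ⟨β, h1, h2⟩ := EReal.lt_iff_exists_real_btwn.1 h
    refine ⟨c, β, EReal.coe_lt_coe_iff.1 h1, ?_⟩
    have hev := (tendsto_fst.mono_left (nhdsWithin_prod_eq p.1 p.2 X Y).le).eventually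
      (hlsc _ hq.1.2 _ hp.1 _ h2)
    filter_upwards [hev, self_mem_nhdsWithin] with w hw hwK
    exact ⟨hc ▸ (hq.2 _ hwK.1 _ hwK.2).1, hw.le⟩

/-! ### The Lyapunov function along a solution -/

theorem IsViableSolution.ae_exists_hasDerivAt {Z : Type*} [NormedAddCommGroup Z]
    [NormedSpace ℝ Z] {K : Set Z} {Φ : Z → Set Z} {z : ℝ → Z} (hz : IsViableSolution K Φ z) :
    ∀ᵐ t, 0 ≤ t → ∃ v ∈ Φ (z t), HasDerivAt z v t :=
  (ae_restrict_iff' measurableSet_Ici).1 hz.deriv_mem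

section Saddle

variable {E F : Type*} [NormedAddCommGroup E] [InnerProductSpace ℝ E] [CompleteSpace E]
  [NormedAddCommGroup F] [InnerProductSpace ℝ F] [CompleteSpace F]
  {X : Set E} {Y : Set F} {L : E → F → EReal} {Rx : E → ℝ} {Rγ : F → ℝ} {σ : ℝ}
  {z : ℝ → E × F} {p q : E × F}

/-- The sum of the Bregman divergences of `q` from `p` in the two variables. -/
noncomputable def lyapunov (Rx : E → ℝ) (Rγ : F → ℝ) (q p : E × F) : ℝ :=
  bregman Rx q.1 p.1 + bregman Rγ q.2 p.2

@[simp]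
theorem lyapunov_self (Rx : E → ℝ) (Rγ : F → ℝ) (q : E × F) : lyapunov Rx Rγ q q = 0 := by
  simp [lyapunov]

theorem lyapunov_nonneg (hRx : IsMirrorMap σ X Rx) (hRγ : IsMirrorMap σ Y Rγ) (hσ : 0 < σ)
    (hq : q ∈ X ×ˢ Y) (hp : p ∈ X ×ˢ Y) : 0 ≤ lyapunov Rx Rγ q p :=
  add_nonneg (hRx.bregman_nonneg hσ hq.1 hp.1) (hRγ.bregman_nonneg hσ hq.2 hp.2)

theorem dist_lt_of_lyapunov_lt (hRx : IsMirrorMap σ X Rx) (hRγ : IsMirrorMap σ Y Rγ)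
    (hσ : 0 < σ) {ε : ℝ} (hε : 0 < ε) (hq : q ∈ X ×ˢ Y) (hp : p ∈ X ×ˢ Y)
    (h : lyapunov Rx Rγ q p < σ / 2 * ε ^ 2) : dist p q < ε := by
  have h1 := hRx.div_two_mul_sq_le_bregman hq.1 hp.1
  have h2 := hRγ.div_two_mul_sq_le_bregman hq.2 hp.2
  have h3 := hRx.bregman_nonneg hσ hq.1 hp.1
  have h4 := hRγ.bregman_nonneg hσ hq.2 hp.2
  rw [lyapunov] at h
  have hσ2 : 0 < σ / 2 := by positivity
  rw [dist_comm, dist_eq_norm, Prod.norm_def, max_lt_iff]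
  constructor <;> refine lt_of_pow_lt_pow_left₀ 2 hε.le (lt_of_mul_lt_mul_left ?_ hσ2.le)
  · exact lt_of_le_of_lt h1 (by linarith)
  · exact lt_of_le_of_lt h2 (by linarith)

theorem continuousOn_lyapunov (hRx : IsMirrorMap σ X Rx) (hRγ : IsMirrorMap σ Y Rγ)
    (q : E × F) : ContinuousOn (lyapunov Rx Rγ q) (X ×ˢ Y) :=
  ((hRx.contDiffOn_bregman q.1).continuousOn.comp continuousOn_fst fun _ h ↦ h.1).add
    ((hRγ.contDiffOn_bregman q.2).continuousOn.comp continuousOn_snd fun _ h ↦ h.2)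

namespace IsViableSolution

theorem absolutelyContinuousOnInterval_lyapunov {Φ : E × F → Set (E × F)}
    (hz : IsViableSolution (X ×ˢ Y) Φ z)
    (hX : Convex ℝ X) (hXc : IsCompact X) (hY : Convex ℝ Y) (hYc : IsCompact Y)
    (hRx : IsMirrorMap σ X Rx) (hRγ : IsMirrorMap σ Y Rγ) (q : E × F) {s t : ℝ} (hs : 0 ≤ s)
    (hst : s ≤ t) : AbsolutelyContinuousOnInterval (fun τ ↦ lyapunov Rx Rγ q (z τ)) s t := by
  have hac := (hz.absCont t (hs.trans hst)).mono (uIcc_subset_uIcc_right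
    (by rw [uIcc_of_le (hs.trans hst)]; exact ⟨hs, hst⟩ : s ∈ uIcc 0 t))
  have hmem (τ) (hτ : τ ∈ uIcc s t) : z τ ∈ X ×ˢ Y :=
    hz.mem τ (hs.trans (uIcc_of_le hst ▸ hτ).1)
  obtain ⟨C, hC⟩ := (hRx.contDiffOn_bregman q.1).exists_lipschitzOnWith (by norm_num) hX hXc
  obtain ⟨D, hD⟩ := (hRγ.contDiffOn_bregman q.2).exists_lipschitzOnWith (by norm_num) hY hYc
  exact ((hC.comp (LipschitzWith.prod_fst.lipschitzOnWith (s := X ×ˢ Y)) fun _ h ↦ h.1)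
      |>.comp_absolutelyContinuousOnInterval hac hmem).add
    ((hD.comp (LipschitzWith.prod_snd.lipschitzOnWith (s := X ×ˢ Y)) fun _ h ↦ h.2)
      |>.comp_absolutelyContinuousOnInterval hac hmem)

variable [FiniteDimensional ℝ E] [FiniteDimensional ℝ F]

/-- Where `L(q.1, γ) ≤ α` and `β ≤ L(x, q.2)` along the solution, the Lyapunov function decreases
at least at the rate `β - α`. -/
theorem lyapunov_sub_le (hz : IsViableSolution (X ×ˢ Y) (mirrorField X Y L Rx Rγ) z)
    (hX : Convex ℝ X) (hXc : IsCompact X) (hY : Convex ℝ Y) (hYc : IsCompact Y)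
    (hfin : ∀ x ∈ X, ∀ γ ∈ Y, ∃ c : ℝ, L x γ = c)
    (hRx : IsMirrorMap σ X Rx) (hRγ : IsMirrorMap σ Y Rγ) (hσ : 0 < σ) (hq : q ∈ X ×ˢ Y)
    {s t α β : ℝ} (hs : 0 ≤ s) (hst : s ≤ t)
    (hα : ∀ τ ∈ Ioo s t, L q.1 (z τ).2 ≤ α) (hβ : ∀ τ ∈ Ioo s t, β ≤ L (z τ).1 q.2) :
    lyapunov Rx Rγ q (z t) - lyapunov Rx Rγ q (z s) ≤ (α - β) * (t - s) := by
  refine (hz.absolutelyContinuousOnInterval_lyapunov hX hXc hY hYc hRx hRγ q hs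
    hst).sub_le_mul_sub hst ?_
  filter_upwards [hz.ae_exists_hasDerivAt] with τ hτ hmem
  have hτ0 : 0 ≤ τ := hs.trans hmem.1.le
  obtain ⟨v, hv, hder⟩ := hτ hτ0
  rw [mirrorField_eq_prod] at hv
  obtain ⟨hxX, hγY⟩ := hz.mem τ hτ0
  have hd1 : HasDerivAt (fun s ↦ (z s).1) v.1 τ :=
    (ContinuousLinearMap.fst ℝ E F).hasFDerivAt.comp_hasDerivAt τ hder
  have hd2 : HasDerivAt (fun s ↦ (z s).2) v.2 τ :=
    (ContinuousLinearMap.snd ℝ E F).hasFDerivAt.comp_hasDerivAt τ hder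
  obtain ⟨r₁, h1, h1'⟩ := exists_hasDerivAt_bregman hX hRx hσ hq.1 hxX hd1 hv.1
  obtain ⟨r₂, h2, h2'⟩ := exists_hasDerivAt_bregman hY hRγ hσ hq.2 hγY hd2 hv.2
  refine ⟨r₁ + r₂, ?_, h1.add h2⟩
  obtain ⟨c, hc⟩ := hfin _ hxX _ hγY
  have hα' := h1'.trans (hα τ hmem)
  have hβ' := h2'.trans (EReal.neg_le_neg_iff.2 (hβ τ hmem))
  simp only [hc] at hα' hβ'
  norm_cast at hα' hβ'
  linarith

theorem lyapunov_le (hz : IsViableSolution (X ×ˢ Y) (mirrorField X Y L Rx Rγ) z)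
    (hX : Convex ℝ X) (hXc : IsCompact X) (hY : Convex ℝ Y) (hYc : IsCompact Y)
    (hfin : ∀ x ∈ X, ∀ γ ∈ Y, ∃ c : ℝ, L x γ = c)
    (hRx : IsMirrorMap σ X Rx) (hRγ : IsMirrorMap σ Y Rγ) (hσ : 0 < σ)
    (hq : q ∈ saddleSet X Y L) {s t : ℝ} (hs : 0 ≤ s) (hst : s ≤ t) :
    lyapunov Rx Rγ q (z t) ≤ lyapunov Rx Rγ q (z s) := by
  obtain ⟨c, hc⟩ := hfin _ hq.1.1 _ hq.1.2
  have hmem (τ) (hτ : τ ∈ Ioo s t) := hz.mem τ (hs.trans hτ.1.le)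
  have := hz.lyapunov_sub_le (α := c) (β := c) hX hXc hY hYc hfin hRx hRγ hσ hq.1 hs hst
    (fun τ hτ ↦ hc ▸ (hq.2 _ (hmem τ hτ).1 _ (hmem τ hτ).2).1)
    (fun τ hτ ↦ hc ▸ (hq.2 _ (hmem τ hτ).1 _ (hmem τ hτ).2).2)
  linarith

/-- Solutions are Lipschitz, although the field is unbounded. -/
theorem dist_le (hz : IsViableSolution (X ×ˢ Y) (mirrorField X Y L Rx Rγ) z)
    (hRx : IsMirrorMap σ X Rx) (hRγ : IsMirrorMap σ Y Rγ) (hσ : 0 < σ) {G : ℝ} (hG : 0 < G)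
    (hGx : ∀ x ∈ X, ∀ γ ∈ Y, ∀ g ∈ subdifferential (fun x' ↦ L x' γ) x, ‖g‖ ≤ G)
    (hGγ : ∀ x ∈ X, ∀ γ ∈ Y, ∀ g ∈ subdifferential (fun γ' ↦ -L x γ') γ, ‖g‖ ≤ G)
    {s t : ℝ} (hs : 0 ≤ s) (hst : s ≤ t) : dist (z t) (z s) ≤ G / σ * (t - s) := by
  have hac := (hz.absCont t (hs.trans hst)).mono (uIcc_subset_uIcc_right
    (by rw [uIcc_of_le (hs.trans hst)]; exact ⟨hs, hst⟩ : s ∈ uIcc 0 t))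
  have hvel : ∀ᵐ τ, τ ∈ Ioo s t →
      (∃ v, ‖v‖ ≤ G / σ ∧ HasDerivAt (fun s ↦ (z s).1) v τ) ∧
        ∃ v, ‖v‖ ≤ G / σ ∧ HasDerivAt (fun s ↦ (z s).2) v τ := by
    filter_upwards [hz.ae_exists_hasDerivAt] with τ hτ hmem
    have hτ0 : 0 < τ := hs.trans_lt hmem.1
    obtain ⟨v, hv, hder⟩ := hτ hτ0.le
    rw [mirrorField_eq_prod] at hv
    obtain ⟨hxX, hγY⟩ := hz.mem τ hτ0.le
    have hmem : ∀ᶠ s in 𝓝 τ, z s ∈ X ×ˢ Y :=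
      (eventually_gt_nhds hτ0).mono fun s hs ↦ hz.mem s hs.le
    have hd1 : HasDerivAt (fun s ↦ (z s).1) v.1 τ :=
      (ContinuousLinearMap.fst ℝ E F).hasFDerivAt.comp_hasDerivAt τ hder
    have hd2 : HasDerivAt (fun s ↦ (z s).2) v.2 τ :=
      (ContinuousLinearMap.snd ℝ E F).hasFDerivAt.comp_hasDerivAt τ hder
    obtain ⟨t1, t1'⟩ := mem_posTangentConeAt_of_hasDerivAt hd1 (hmem.mono fun _ h ↦ h.1)
    obtain ⟨t2, t2'⟩ := mem_posTangentConeAt_of_hasDerivAt hd2 (hmem.mono fun _ h ↦ h.2)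
    exact ⟨⟨_, norm_le_of_mem_descentField hRx hσ hxX (hGx _ hxX _ hγY) hv.1 t1 t1', hd1⟩,
      ⟨_, norm_le_of_mem_descentField hRγ hσ hγY (hGγ _ hxX _ hγY) hv.2 t2 t2', hd2⟩⟩
  have hM : 0 ≤ G / σ := by positivity
  rw [dist_eq_norm, Prod.norm_def]
  refine max_le ?_ ?_
  · exact (LipschitzWith.prod_fst.lipschitzOnWith.comp_absolutelyContinuousOnInterval hac
      (mapsTo_univ _ _)).norm_sub_le_mul_sub hst hM (hvel.mono fun τ h hτ ↦ (h hτ).1)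
  · exact (LipschitzWith.prod_snd.lipschitzOnWith.comp_absolutelyContinuousOnInterval hac
      (mapsTo_univ _ _)).norm_sub_le_mul_sub hst hM (hvel.mono fun τ h hτ ↦ (h hτ).2)

end IsViableSolution

/-! ### Stability and convergence -/

variable [FiniteDimensional ℝ E] [FiniteDimensional ℝ F]

theorem isLyapunovStable_of_mem_saddleSet
    (hX : Convex ℝ X) (hXc : IsCompact X) (hY : Convex ℝ Y) (hYc : IsCompact Y)
    (hfin : ∀ x ∈ X, ∀ γ ∈ Y, ∃ c : ℝ, L x γ = c)
    (hRx : IsMirrorMap σ X Rx) (hRγ : IsMirrorMap σ Y Rγ) (hσ : 0 < σ)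
    (hq : q ∈ saddleSet X Y L) :
    IsLyapunovStable (X ×ˢ Y) (mirrorField X Y L Rx Rγ) q := by
  intro ε hε
  have hpos : lyapunov Rx Rγ q q < σ / 2 * ε ^ 2 := by
    rw [lyapunov_self]
    positivity
  obtain ⟨δ, hδ, hball⟩ := Metric.mem_nhdsWithin_iff.1
    ((continuousOn_lyapunov hRx hRγ q q hq.1).eventually_lt_const hpos)
  refine ⟨δ, hδ, fun z₀ hz₀ z hz h0 t ht ↦ ⟨?_, hz.mem t ht⟩⟩
  refine dist_lt_of_lyapunov_lt hRx hRγ hσ hε hq.1 (hz.mem t ht) ?_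
  refine lt_of_le_of_lt (hz.lyapunov_le hX hXc hY hYc hfin hRx hRγ hσ hq le_rfl ht) ?_
  rw [h0]
  exact hball hz₀

/-- Every cluster point of a solution is a saddle point: near any other point a Lyapunov function
decreases at a definite rate, and a Lipschitz solution with that cluster point would spend there
infinitely many time intervals of a fixed length. -/
theorem mem_saddleSet_of_mapClusterPt
    (hX : Convex ℝ X) (hXc : IsCompact X) (hY : Convex ℝ Y) (hYc : IsCompact Y)
    (hfin : ∀ x ∈ X, ∀ γ ∈ Y, ∃ c : ℝ, L x γ = c)
    (hsep : ∀ p ∈ (X ×ˢ Y) \ saddleSet X Y L, ∃ q ∈ saddleSet X Y L,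
      L q.1 p.2 < L q.1 q.2 ∨ L q.1 q.2 < L p.1 q.2)
    (husc : ∀ x ∈ X, UpperSemicontinuousOn (fun γ ↦ L x γ) Y)
    (hlsc : ∀ γ ∈ Y, LowerSemicontinuousOn (fun x ↦ L x γ) X)
    (hRx : IsMirrorMap σ X Rx) (hRγ : IsMirrorMap σ Y Rγ) (hσ : 0 < σ) {G : ℝ} (hG : 0 < G)
    (hGx : ∀ x ∈ X, ∀ γ ∈ Y, ∀ g ∈ subdifferential (fun x' ↦ L x' γ) x, ‖g‖ ≤ G)
    (hGγ : ∀ x ∈ X, ∀ γ ∈ Y, ∀ g ∈ subdifferential (fun γ' ↦ -L x γ') γ, ‖g‖ ≤ G)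
    (hz : IsViableSolution (X ×ˢ Y) (mirrorField X Y L Rx Rγ) z)
    (hp : p ∈ X ×ˢ Y) (hcl : MapClusterPt p atTop z) : p ∈ saddleSet X Y L := by
  by_contra hpS
  obtain ⟨q, hq, α, β, hαβ, hev⟩ :=
    exists_eventually_gap hfin (hsep p ⟨hp, hpS⟩) husc hlsc hp
  obtain ⟨r, hr, hball⟩ := Metric.mem_nhdsWithin_iff.1 hev
  -- the time in which a solution at distance `r / 2` from `p` cannot leave the ball of radius `r`
  set T : ℝ := r / 2 / (G / σ) with hT
  have hM : 0 < G / σ := div_pos hG hσ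
  have hTpos : 0 < T := by positivity
  set V : ℝ → ℝ := fun t ↦ lyapunov Rx Rγ q (z t) with hV
  have hanti {s t : ℝ} (hs : 0 ≤ s) (hst : s ≤ t) : V t ≤ V s :=
    hz.lyapunov_le hX hXc hY hYc hfin hRx hRγ hσ hq hs hst
  have hbdd : BddBelow (V '' Ici 0) := by
    refine ⟨0, ?_⟩
    rintro _ ⟨t, ht, rfl⟩
    exact lyapunov_nonneg hRx hRγ hσ hq.1 (hz.mem t ht)
  -- after time `s` less than `(β - α) * T` is left to lose, which is the loss over one visit
  obtain ⟨_, ⟨s, hs, rfl⟩, hsV⟩ := exists_lt_of_csInf_lt (nonempty_Ici.image V)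
    (lt_add_of_pos_right (sInf (V '' Ici 0)) (mul_pos (sub_pos.2 hαβ) hTpos))
  have hs : 0 ≤ s := hs
  obtain ⟨t, ht, hst⟩ := ((hcl.frequently (Metric.ball_mem_nhds p (half_pos hr))).and_eventually
    (eventually_ge_atTop s)).exists
  have ht0 : 0 ≤ t := hs.trans hst
  have hgap (τ) (hτ : τ ∈ Ioo t (t + T)) : L q.1 (z τ).2 ≤ α ∧ β ≤ L (z τ).1 q.2 := by
    refine hball ⟨?_, hz.mem τ (ht0.trans hτ.1.le)⟩
    have h1 := hz.dist_le hRx hRγ hσ hG hGx hGγ ht0 hτ.1.le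
    have h2 : G / σ * (τ - t) < r / 2 := by
      rw [mul_comm, ← lt_div_iff₀ hM]
      linarith [hτ.2]
    have h3 : dist (z t) p < r / 2 := ht
    rw [Metric.mem_ball]
    linarith [dist_triangle (z τ) (z t) p]
  have hdrop := hz.lyapunov_sub_le hX hXc hY hYc hfin hRx hRγ hσ hq.1 ht0
    (le_add_of_nonneg_right hTpos.le) (fun τ hτ ↦ (hgap τ hτ).1) (fun τ hτ ↦ (hgap τ hτ).2)
  have hinf : sInf (V '' Ici 0) ≤ V (t + T) :=
    csInf_le hbdd ⟨t + T, add_nonneg ht0 hTpos.le, rfl⟩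
  have hts := hanti hs hst
  simp only [hV] at hdrop hinf hts hsV
  rw [add_sub_cancel_left] at hdrop
  linarith

end Saddle

theorem tendsto_infDist_of_forall_mapClusterPt_mem {α : Type*} [PseudoMetricSpace α]
    {K S : Set α} (hK : IsCompact K) {z : ℝ → α} (hz : ∀ t, 0 ≤ t → z t ∈ K)
    (hcl : ∀ p ∈ K, MapClusterPt p atTop z → p ∈ S) :
    Tendsto (fun t ↦ Metric.infDist (z t) S) atTop (𝓝 0) := by
  rw [Metric.tendsto_nhds]
  intro ε hε
  by_contra hcon
  have hclosed : IsClosed {w | ε ≤ Metric.infDist w S} :=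
    isClosed_le continuous_const (Metric.continuous_infDist_pt S)
  obtain ⟨p, hp, hpcl⟩ := (hK.inter_right hclosed).exists_mapClusterPt_of_frequently (l := atTop)
    (f := z) ((not_eventually.1 hcon).and_eventually (eventually_ge_atTop 0) |>.mono
      fun t ht ↦ ⟨hz t ht.2, by
        simpa [Real.dist_eq, abs_of_nonneg Metric.infDist_nonneg] using ht.1⟩)
  have h0 := Metric.infDist_zero_of_mem (hcl p hp.1 hpcl)
  have h1 : ε ≤ Metric.infDist p S := hp.2
  linarith

end SPMD

theorem mainTheorem2 (n m : ℕ)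
    (X : Set (EuclideanSpace ℝ (Fin n))) (Y : Set (EuclideanSpace ℝ (Fin m)))
    (hXne : X.Nonempty) (hXconv : Convex ℝ X) (hXcomp : IsCompact X)
    (hYne : Y.Nonempty) (hYconv : Convex ℝ Y) (hYcomp : IsCompact Y)
    (L : EuclideanSpace ℝ (Fin n) → EuclideanSpace ℝ (Fin m) → EReal)
    (hLconvex : ∀ γ, SPMD.EConvex (fun x => L x γ))
    (hLconcave : ∀ x, SPMD.EConcave (fun γ => L x γ))
    (hSne : (SPMD.saddleSet X Y L).Nonempty)
    (hScomp : IsCompact (SPMD.saddleSet X Y L))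
    (hSsep : ∀ p ∈ (X ×ˢ Y) \ SPMD.saddleSet X Y L, ∃ q ∈ SPMD.saddleSet X Y L,
      L q.1 p.2 < L q.1 q.2 ∨ L q.1 q.2 < L p.1 q.2)
    (hLusc : ∀ x ∈ X, UpperSemicontinuousOn (fun γ => L x γ) Y)
    (hLlsc : ∀ γ ∈ Y, LowerSemicontinuousOn (fun x => L x γ) X)
    (hSubNe : ∀ x ∈ X, ∀ γ ∈ Y,
      (SPMD.subdifferential (fun x' => L x' γ) x).Nonempty ∧
        (SPMD.superdifferential (fun γ' => L x γ') γ).Nonempty)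
    (G : ℝ) (hG : 0 < G)
    (hSubBdd : ∀ x ∈ X, ∀ γ ∈ Y,
      (∀ g ∈ SPMD.subdifferential (fun x' => L x' γ) x, ‖g‖ ≤ G) ∧
        (∀ g ∈ SPMD.superdifferential (fun γ' => L x γ') γ, ‖g‖ ≤ G))
    (σ : ℝ) (hσ : 0 < σ)
    (Rx : EuclideanSpace ℝ (Fin n) → ℝ) (hRx : SPMD.IsMirrorMap σ X Rx)
    (Rγ : EuclideanSpace ℝ (Fin m) → ℝ) (hRγ : SPMD.IsMirrorMap σ Y Rγ) :
    (∀ p, p ∈ SPMD.saddleSet X Y L ↔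
      SPMD.IsEquilibrium (X ×ˢ Y) (SPMD.mirrorField X Y L Rx Rγ) p) ∧
    (∀ p ∈ SPMD.saddleSet X Y L,
      SPMD.IsLyapunovStable (X ×ˢ Y) (SPMD.mirrorField X Y L Rx Rγ) p) ∧
    (∀ z₀ ∈ X ×ˢ Y, ∀ z : ℝ → EuclideanSpace ℝ (Fin n) × EuclideanSpace ℝ (Fin m),
      SPMD.IsViableSolution (X ×ˢ Y) (SPMD.mirrorField X Y L Rx Rγ) z → z 0 = z₀ →
        Tendsto (fun t => Metric.infDist (z t) (SPMD.saddleSet X Y L)) atTop (𝓝 0)) := by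
  have hnex (x) (hx : x ∈ X) (γ) (hγ : γ ∈ Y) := (hSubNe x hx γ hγ).1
  have hGx (x) (hx : x ∈ X) (γ) (hγ : γ ∈ Y) := (hSubBdd x hx γ hγ).1
  have hneγ (x) (hx : x ∈ X) (γ) (hγ : γ ∈ Y) :
      (SPMD.subdifferential (fun γ' ↦ -L x γ') γ).Nonempty :=
    let ⟨_, hg⟩ := (hSubNe x hx γ hγ).2
    ⟨_, SPMD.mem_superdifferential_iff.1 hg⟩
  have hGγ (x) (hx : x ∈ X) (γ) (hγ : γ ∈ Y) (g)
      (hg : g ∈ SPMD.subdifferential (fun γ' ↦ -L x γ') γ) : ‖g‖ ≤ G := by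
    rw [← norm_neg]
    exact (hSubBdd x hx γ hγ).2 _ (SPMD.mem_superdifferential_iff.2 (by rwa [neg_neg]))
  refine ⟨fun p ↦ and_congr_right fun hp ↦ ?_, ?_⟩
  · rw [SPMD.mirrorField_eq_prod, mem_prod, Prod.fst_zero, Prod.snd_zero,
      SPMD.zero_mem_descentField_iff hXconv hXcomp hRx hσ (fun x hx ↦ hnex x hx _ hp.2)
        (fun x hx ↦ hGx x hx _ hp.2) hp.1,
      SPMD.zero_mem_descentField_iff hYconv hYcomp hRγ hσ (hneγ _ hp.1) (hGγ _ hp.1) hp.2]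
    simp only [EReal.neg_le_neg_iff]
    exact ⟨fun h ↦ ⟨fun x hx ↦ (h x hx _ hp.2).2, fun γ hγ ↦ (h _ hp.1 γ hγ).1⟩,
      fun h x hx γ hγ ↦ ⟨h.2 γ hγ, h.1 x hx⟩⟩
  -- `L` can take infinite values on `X × Y` only if both spaces are trivial
  rcases subsingleton_or_nontrivial (EuclideanSpace ℝ (Fin n) × EuclideanSpace ℝ (Fin m))
    with _ | hnt
  · refine ⟨fun p _ ε hε ↦ ⟨1, one_pos, fun z₀ _ z hz _ t ht ↦ ⟨?_, hz.mem t ht⟩⟩,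
      fun z₀ _ z _ _ ↦ ?_⟩
    · rw [Subsingleton.elim (z t) p]
      exact Metric.mem_ball_self hε
    · obtain ⟨p, hp⟩ := hSne
      have h0 (t) : Metric.infDist (z t) (SPMD.saddleSet X Y L) = 0 :=
        Metric.infDist_zero_of_mem (Subsingleton.elim p (z t) ▸ hp)
      simp only [h0, tendsto_const_nhds_iff]
  have hfin (x) (hx : x ∈ X) (γ) (hγ : γ ∈ Y) : ∃ c : ℝ, L x γ = c := by
    rcases subsingleton_or_nontrivial (EuclideanSpace ℝ (Fin n)) with _ | _
    · rcases subsingleton_or_nontrivial (EuclideanSpace ℝ (Fin m)) with _ | _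
      · obtain ⟨p, w, hpw⟩ := hnt
        exact absurd (Prod.ext (Subsingleton.elim _ _) (Subsingleton.elim _ _)) hpw
      · obtain ⟨c, hc⟩ := SPMD.exists_coe_eq_of_subdifferential (hneγ x hx γ hγ) (hGγ x hx γ hγ)
        exact ⟨-c, by rw [EReal.coe_neg, ← hc, neg_neg]⟩
    · exact SPMD.exists_coe_eq_of_subdifferential (f := fun x' ↦ L x' γ) (hnex x hx γ hγ)
        (hGx x hx γ hγ)
  refine ⟨fun p hp ↦ SPMD.isLyapunovStable_of_mem_saddleSet hXconv hXcomp hYconv hYcomp hfin hRx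
    hRγ hσ hp, fun z₀ _ z hz _ ↦ ?_⟩
  exact SPMD.tendsto_infDist_of_forall_mapClusterPt_mem (hXcomp.prod hYcomp) hz.mem
    fun p hp hcl ↦ SPMD.mem_saddleSet_of_mapClusterPt hXconv hXcomp hYconv hYcomp hfin hSsep hLusc
      hLlsc hRx hRγ hσ hG hGx hGγ hz hp hcl
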